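/- Let $k$ be a field with algebraic closure $\bar k$. Let $N, d, r$ be integers with $N \ge 3$ and $d \ge r \ge 1$, and suppose that $$\binom{d+2}{2} - \binom{d-r+2}{2} - x_{r,N} > 0, \qquad x_{r,N} = \begin{cases} 2N-2 & \text{if } r = 1,\\ \binom{r+2}{2}+3N-7 & \text{if } r > 1.\end{cases}$$ Let $\Gamma_{d,N}$ be the projective space of hypersurfaces of degree $d$ in $\mathbf{P}^N$ over $\bar k$, i.e. of nonzero forms of degree $d$ in $N+1$ variables up to scalars. A plane curve of degree $r$ in $\mathbf{P}^N$ is a closed subscheme $C$ of some plane $\Pi \subset \mathbf{P}^N$ over $\bar k$ that is defined in $\Pi$ by a nonzero form of degree $r$ (so $C$ may be reducible or non-reduced). Then a generic hypersurface of degree $d$ in $\mathbf{P}^N$ contains no plane curve of degree $r$: there is a nonempty Zariski open subset $U \subset \Gamma_{d,N}$, defined over $k$, such that no hypersurface $H \in U$ contains, as a subscheme, a plane curve of degree $r$ in $\mathbf{P}^N$ over $\bar k$. -/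

import Mathlib

/-- The space of forms (homogeneous polynomials) of degree `d` in `N + 1` variables over `K`. -/
abbrev FormSpace (K : Type*) [Field K] (N d : ℕ) : Type _ :=
  MvPolynomial.homogeneousSubmodule (Fin (N + 1)) K d

/-- The hypersurfaces of degree `d` in the projective space `P^N` over `K`: the points of the
projective space of lines in the space of forms of degree `d`. -/
abbrev Hypersurface (K : Type*) [Field K] (N d : ℕ) : Type _ :=
  Projectivization K (FormSpace K N d)

namespace Hypersurface

/-- The exponents of the monomials of degree `d` in `N + 1` variables. They index the homogeneous
coordinates on the space of hypersurfaces of degree `d`. -/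
abbrev Exponent (N d : ℕ) : Type := {m : Fin (N + 1) →₀ ℕ // m.degree = d}

/-- A form of degree `d` that is an equation of the hypersurface (unique up to a nonzero scalar). -/
noncomputable def equation {K : Type*} [Field K] {N d : ℕ} (H : Hypersurface K N d) :
    MvPolynomial (Fin (N + 1)) K :=
  (Projectivization.rep H : FormSpace K N d).1

/-- Homogeneous coordinates of a hypersurface: the coefficients of its equation. -/
noncomputable def coords {K : Type*} [Field K] {N d : ℕ} (H : Hypersurface K N d) :
    Exponent N d → K :=
  fun m => MvPolynomial.coeff m.1 (equation H)

/-- For a field extension `K / k`, a set of hypersurfaces of degree `d` over `K` is Zariski closed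
and defined over `k` if it is the set of common zeros of a set of homogeneous polynomials with
coefficients in `k`, in the homogeneous coordinates on the space of hypersurfaces. -/
def IsZariskiClosed (k : Type*) {K : Type*} [Field k] [Field K] [Algebra k K] {N d : ℕ}
    (Z : Set (Hypersurface K N d)) : Prop :=
  ∃ S : Set (MvPolynomial (Exponent N d) k),
    (∀ G ∈ S, ∃ e : ℕ, G.IsHomogeneous e) ∧
    ∀ H : Hypersurface K N d, H ∈ Z ↔ ∀ G ∈ S, MvPolynomial.aeval (coords H) G = 0

/-- A set of hypersurfaces is Zariski open and defined over `k` if its complement is Zariski closed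
and defined over `k`. -/
def IsZariskiOpen (k : Type*) {K : Type*} [Field k] [Field K] [Algebra k K] {N d : ℕ}
    (U : Set (Hypersurface K N d)) : Prop :=
  IsZariskiClosed k Uᶜ

end Hypersurface

/-- A plane curve of degree `r` in `P^N` over `K`, possibly reducible or non-reduced: a plane, given
by three linearly independent vectors of `K^(N+1)`, together with a nonzero form of degree `r` in
the three resulting homogeneous coordinates on that plane. -/
structure PlaneCurve (K : Type*) [Field K] (N r : ℕ) where
  /-- Three vectors that span the plane. -/
  frame : Fin 3 → Fin (N + 1) → K
  linearIndependent_frame : LinearIndependent K frame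
  /-- The equation of the curve in its plane. -/
  form : MvPolynomial (Fin 3) K
  form_homogeneous : form.IsHomogeneous r
  form_ne_zero : form ≠ 0

namespace PlaneCurve

/-- Restriction of polynomials on `K^(N+1)` to the plane of the curve: the substitution
`X_i ↦ ∑ j, (frame j)_i * X_j`. -/
noncomputable def restrict {K : Type*} [Field K] {N r : ℕ} (C : PlaneCurve K N r) :
    MvPolynomial (Fin (N + 1)) K →ₐ[K] MvPolynomial (Fin 3) K :=
  MvPolynomial.aeval fun i => ∑ j : Fin 3, MvPolynomial.C (C.frame j i) * MvPolynomial.X j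

/-- The homogeneous ideal of the curve as a closed subscheme of `P^N`: the polynomials whose
restriction to the plane lies in the ideal generated by the equation of the curve. -/
noncomputable def ideal {K : Type*} [Field K] {N r : ℕ} (C : PlaneCurve K N r) :
    Ideal (MvPolynomial (Fin (N + 1)) K) :=
  (Ideal.span {C.form}).comap C.restrict.toRingHom

end PlaneCurve

/-- The hypersurface `H` contains the plane curve `C`, as closed subschemes of `P^N`: the ideal of
`H` is contained in the ideal of `C`. -/
def Hypersurface.Contains {K : Type*} [Field K] {N d r : ℕ} (H : Hypersurface K N d)
    (C : PlaneCurve K N r) : Prop :=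
  Ideal.span {Hypersurface.equation H} ≤ C.ideal

/-- The integer `x_{r,N}`. -/
def xInt (r N : ℕ) : ℤ :=
  if r = 1 then 2 * (N : ℤ) - 2 else (Nat.choose (r + 2) 2 : ℤ) + 3 * (N : ℤ) - 7

/-!
The proof is a count of parameters. The forms of degree `d` on `K^(N+1)` whose restriction to some
plane is divisible by a form of degree `r` are the values of finitely many polynomial maps, defined
over `k`, in fewer parameters than there are monomials of degree `d`. More polynomials than
variables are algebraically dependent (`exists_relation`), so the coefficients of these forms satisfy
a nontrivial polynomial relation over `k`. These forms make up a cone, hence a nonzero homogeneous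
component of the relation vanishes on them as well (`exists_homogeneous_vanishing_on_cone`), and
the complement of its zero locus is the required open set; it is nonempty because `K` is infinite.

The polynomial maps come from the affine charts of the Grassmannian. After a change of basis, the
frame of a linear subspace contains an identity submatrix (`exists_chart`), in the columns given by
an embedding `e`. In this chart a form `F` is determined by the frame, by its restriction to the
subspace, and by its coefficients at the monomials that involve a variable outside the image of `e`:
the remaining coefficients can be solved for (`chartForm_eq`). The number of parameters is therefore
less than the number of monomials of degree `d` on the whole space as soon as the dimension of the
Grassmannian plus the number of parameters for the restriction is less than the number of monomials
of degree `d` on the subspace (`exists_relation_linSub`).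

For `r > 1` the subspaces are planes and the restriction is a product of forms of degrees `r` and
`d - r`, one coefficient of the first being normalized to `1`; the condition reads
`3 (N - 2) + (binom (r + 2) 2 - 1) + binom (d - r + 2) 2 < binom (d + 2) 2`. For `r = 1` the
subspaces are lines and the restriction is zero; the condition reads `2 (N - 1) < d + 1`. Both
conditions are the hypothesis on `xInt r N` (`exists_relation_planeCurve`).
-/

open MvPolynomial

/-! ### Forms and their coefficients -/

/-- The exponents of the monomials of degree `d` in variables indexed by `ι`. -/
abbrev Exps (ι : Type) (d : ℕ) : Type := {m : ι →₀ ℕ // m.degree = d}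

noncomputable instance Exps.fintype (ι : Type) [Finite ι] (d : ℕ) : Fintype (Exps ι d) :=
  (Finsupp.finite_of_degree_eq (σ := ι) d).fintype

theorem Exps.card (n d : ℕ) : Fintype.card (Exps (Fin n) d) = (n + d - 1).choose d := by
  have h := Finset.card_finsuppAntidiag_nat_eq_choose (s := (Finset.univ : Finset (Fin n))) d
  rw [Finset.card_univ, Fintype.card_fin] at h
  rw [← h, ← Fintype.card_coe]
  refine Fintype.card_congr (Equiv.subtypeEquivRight fun m => ?_)
  simp [Finset.mem_finsuppAntidiag, Finsupp.degree_eq_sum]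

/-- The form of degree `d` with given coefficients. -/
noncomputable def formOfCoeffs {R : Type*} [CommRing R] {ι : Type} [Finite ι] {d : ℕ}
    (c : Exps ι d → R) : MvPolynomial ι R :=
  ∑ m, monomial m.1 (c m)

section Forms

variable {R S : Type*} [CommRing R] [CommRing S] {ι : Type} {d : ℕ}

theorem coeff_formOfCoeffs [Finite ι] (c : Exps ι d → R) (m : Exps ι d) :
    coeff m.1 (formOfCoeffs c) = c m := by
  classical
  simp [formOfCoeffs, coeff_sum, coeff_monomial, ← Subtype.ext_iff]

theorem formOfCoeffs_isHomogeneous [Finite ι] (c : Exps ι d → R) :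
    (formOfCoeffs c).IsHomogeneous d :=
  IsHomogeneous.sum _ _ _ fun m _ => isHomogeneous_monomial _ m.2

theorem MvPolynomial.IsHomogeneous.eq_of_coeff_eq {F F' : MvPolynomial ι R}
    (hF : F.IsHomogeneous d) (hF' : F'.IsHomogeneous d)
    (h : ∀ m : Exps ι d, coeff m.1 F = coeff m.1 F') : F = F' := by
  ext m
  by_cases hm : m.degree = d
  · exact h ⟨m, hm⟩
  · rw [hF.coeff_eq_zero hm, hF'.coeff_eq_zero hm]

theorem formOfCoeffs_coeff [Finite ι] {F : MvPolynomial ι R} (hF : F.IsHomogeneous d) :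
    formOfCoeffs (fun m : Exps ι d => coeff m.1 F) = F :=
  (formOfCoeffs_isHomogeneous _).eq_of_coeff_eq hF fun m => coeff_formOfCoeffs _ m

theorem map_formOfCoeffs [Finite ι] (φ : R →+* S) (c : Exps ι d → R) :
    map φ (formOfCoeffs c) = formOfCoeffs (fun m => φ (c m)) := by
  simp [formOfCoeffs, map_monomial]

end Forms

/-! ### Linear substitutions -/

/-- The linear substitution `X_i ↦ ∑ a, v a i * X_a`: restriction of polynomials to the linear
subspace parametrized by the rows of `v`. -/
noncomputable def linSub {R : Type*} [CommRing R] {ι κ : Type} [Fintype κ] (v : κ → ι → R) :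
    MvPolynomial ι R →ₐ[R] MvPolynomial κ R :=
  aeval fun i => ∑ a, C (v a i) * X a

section LinSub

variable {R S : Type*} [CommRing R] [CommRing S] {ι κ κ' : Type} [Fintype κ] [Fintype κ']

theorem linSub_linSub (g : κ' → κ → R) (v : κ → ι → R) (F : MvPolynomial ι R) :
    linSub g (linSub v F) = linSub (fun a i => ∑ c, g a c * v c i) F := by
  rw [← AlgHom.comp_apply]
  congr 1
  ext1 i
  simp only [linSub, AlgHom.comp_apply, aeval_X, map_sum, map_mul, algHom_C, Finset.mul_sum,
    Finset.sum_mul, algebraMap_eq]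
  rw [Finset.sum_comm]
  refine Finset.sum_congr rfl fun a _ => Finset.sum_congr rfl fun c _ => by ring

theorem map_linSub (φ : R →+* S) (v : κ → ι → R) (F : MvPolynomial ι R) :
    map φ (linSub v F) = linSub (fun a i => φ (v a i)) (map φ F) := by
  induction F using MvPolynomial.induction_on with
  | C a => simp [linSub]
  | add p q hp hq => simp only [map_add, hp, hq]
  | mul_X p i hp => simp only [map_mul, hp, map_X]; simp [linSub]

theorem linSub_isHomogeneous (v : κ → ι → R) {F : MvPolynomial ι R} {d : ℕ}
    (hF : F.IsHomogeneous d) : (linSub v F).IsHomogeneous d := by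
  have := hF.aeval (fun i => ∑ a, C (v a i) * X a) (n := 1)
    fun i => IsHomogeneous.sum _ _ _ fun a _ => isHomogeneous_C_mul_X _ _
  rwa [one_mul] at this

/-- If `v` is the identity on the variables in the image of `e`, then restriction to the subspace
is a retraction onto the polynomials in these variables. -/
theorem linSub_rename {e : κ → ι} [DecidableEq κ] {v : κ → ι → R}
    (hv : ∀ a b, v a (e b) = if a = b then 1 else 0) (q : MvPolynomial κ R) :
    linSub v (rename e q) = q := by
  rw [linSub, aeval_rename]
  simp [Function.comp_def, hv]

end LinSub

/-- Linearly independent rows have a basis whose matrix contains an identity submatrix: a linear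
subspace lies in one of the standard affine charts of the Grassmannian. -/
theorem exists_chart {K : Type*} [Field K] {ι κ : Type} [Fintype ι] [Fintype κ] [DecidableEq κ]
    {v : κ → ι → K} (hv : LinearIndependent K v) :
    ∃ (e : κ ↪ ι) (g : κ → κ → K), ∀ a b, ∑ c, g a c * v c (e b) = if a = b then 1 else 0 := by
  let A : Matrix κ ι K := Matrix.of v
  obtain ⟨t, e, he, hspan, hli⟩ := exists_linearIndependent' K A.col
  have hrank : Module.finrank K (Submodule.span K (Set.range (A.col ∘ e))) = Fintype.card κ := by
    rw [hspan, ← Matrix.rank_eq_finrank_span_cols]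
    exact LinearIndependent.rank_matrix (M := A) hv
  have : Finite t := Finite.of_injective e he
  have : Fintype t := Fintype.ofFinite t
  rw [finrank_span_eq_card hli] at hrank
  let s : κ ≃ t := (Fintype.equivOfCardEq hrank).symm
  let M : Matrix κ κ K := A.submatrix id (e ∘ s)
  have hM : IsUnit M := by
    rw [← Matrix.linearIndependent_cols_iff_isUnit]
    exact hli.comp s s.injective
  obtain ⟨M', h⟩ := hM.exists_left_inv
  refine ⟨⟨e ∘ s, he.comp s.injective⟩, M', fun a b => ?_⟩
  rw [← Matrix.one_apply, ← h, Matrix.mul_apply]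
  rfl

/-! ### Polynomial relations -/

/-- More polynomials than variables satisfy a nontrivial polynomial relation. -/
theorem exists_relation {k : Type*} [Field k] {σ ι : Type} [Fintype σ] [Fintype ι]
    (h : Fintype.card σ < Fintype.card ι) (f : ι → MvPolynomial σ k) :
    ∃ G : MvPolynomial ι k, G ≠ 0 ∧ aeval f G = 0 := by
  by_contra! hG
  have hf : AlgebraicIndependent k f := by
    rw [algebraicIndependent_iff]
    exact fun G h0 => by_contra fun hne => hG G hne h0
  have := hf.lift_cardinalMk_le_trdeg
  rw [MvPolynomial.trdeg_of_isDomain] at this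
  simp at this
  omega

theorem MvPolynomial.IsHomogeneous.aeval_smul {k K : Type*} [CommRing k] [CommRing K]
    [Algebra k K] {ι : Type*} {G : MvPolynomial ι k} {s : ℕ} (hG : G.IsHomogeneous s) (c : K)
    (y : ι → K) :
    MvPolynomial.aeval (c • y) G = c ^ s * MvPolynomial.aeval y G := by
  simp only [aeval_def, eval₂_eq, Pi.smul_apply, smul_eq_mul, mul_pow, Finset.prod_mul_distrib,
    Finset.prod_pow_eq_pow_sum, Finset.mul_sum]
  refine Finset.sum_congr rfl fun m hm => ?_
  rw [hG.degree_eq_sum_deg_support hm]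
  ring

/-- A polynomial has a nonzero homogeneous component, and it vanishes on each line through the
origin on which the polynomial vanishes. -/
theorem exists_homogeneous_vanishing_on_cone {k K : Type*} [Field k] [Field K] [Algebra k K]
    [Infinite K] {ι : Type} {G : MvPolynomial ι k} (hG : G ≠ 0) :
    ∃ (s : ℕ) (G' : MvPolynomial ι k), G'.IsHomogeneous s ∧ G' ≠ 0 ∧
      ∀ y : ι → K, (∀ c : K, aeval (c • y) G = 0) → aeval y G' = 0 := by
  obtain ⟨m, hm⟩ := ne_zero_iff.1 hG
  refine ⟨m.degree, homogeneousComponent m.degree G, homogeneousComponent_isHomogeneous _ _,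
    ne_zero_iff.2 ⟨m, by simpa [coeff_homogeneousComponent] using hm⟩, fun y hy => ?_⟩
  obtain ⟨b, hb⟩ : ∃ b : ℕ → K, ∀ i, b i = aeval y (homogeneousComponent i G) :=
    ⟨_, fun _ => rfl⟩
  have hP : ∑ i ∈ Finset.range (G.totalDegree + 1), Polynomial.C (b i) * Polynomial.X ^ i = 0 := by
    refine Polynomial.funext fun c => ?_
    rw [Polynomial.eval_zero, ← hy c]
    conv_rhs => rw [← sum_homogeneousComponent G]
    simp only [Polynomial.eval_finsetSum, Polynomial.eval_mul, Polynomial.eval_C,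
      Polynomial.eval_pow, Polynomial.eval_X, map_sum, hb,
      (homogeneousComponent_isHomogeneous _ G).aeval_smul, mul_comm]
  have h := congrArg (Polynomial.coeff · m.degree) hP
  have hle : m.degree < G.totalDegree + 1 :=
    Nat.lt_succ_of_le (le_totalDegree (mem_support_iff.2 hm))
  rw [← hb]
  simpa [Polynomial.finsetSum_coeff, Polynomial.coeff_C_mul, Polynomial.coeff_X_pow, hle] using h

/-! ### Families of hypersurfaces through prescribed linear sections -/

section Chart

variable {ι κ : Type} [Fintype ι] [Fintype κ] {d : ℕ}

/-- The exponents of degree `d` that involve a variable outside the image of `e`. -/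
abbrev OffExps (e : κ ↪ ι) (d : ℕ) : Type := {m : Exps ι d // ∃ j ∉ Set.range e, m.1 j ≠ 0}

/-- The monomials in the variables in the image of `e` are those that `OffExps` leaves out, so that
prescribing the restriction to a linear subspace costs as many coefficients as there are monomials
on that subspace. -/
theorem card_exps_add_card_offExps_le (e : κ ↪ ι) (d : ℕ) [Fintype (OffExps e d)] :
    Fintype.card (Exps κ d) + Fintype.card (OffExps e d) ≤ Fintype.card (Exps ι d) := by
  rw [← Fintype.card_sum]
  let f : Exps κ d → Exps ι d := fun m => ⟨m.1.embDomain e, by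
    rw [Finsupp.embDomain_eq_mapDomain, Finsupp.degree_mapDomain, m.2]⟩
  have hf : Function.Injective f := fun m m' h =>
    Subtype.ext (Finsupp.embDomain_injective e (congrArg Subtype.val h))
  refine Fintype.card_le_of_injective (Sum.elim f Subtype.val)
    (hf.sumElim Subtype.val_injective ?_)
  rintro m ⟨m', j, hj, hm'⟩ h
  refine hm' ?_
  have h' : f m = m' := h
  rw [← h']
  exact Finsupp.embDomain_of_notMem_range _ _ _ hj

variable {R S : Type*} [CommRing R] [CommRing S]

open Classical in
/-- The frame of a linear subspace in the affine chart of the Grassmannian given by `e`: the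
columns with index in the image of `e` form the identity matrix. -/
noncomputable def chartFrame (e : κ ↪ ι) (A : κ × {j // j ∉ Set.range e} → R) : κ → ι → R :=
  fun a i => if h : i ∈ Set.range e then (if e a = i then 1 else 0) else A (a, ⟨i, h⟩)

open Classical in
/-- The form with given coefficients at the monomials that involve a variable outside the image of
`e`, and no other monomials. -/
noncomputable def offForm (e : κ ↪ ι) (c : OffExps e d → R) : MvPolynomial ι R :=
  formOfCoeffs fun m : Exps ι d => if h : ∃ j ∉ Set.range e, m.1 j ≠ 0 then c ⟨m, h⟩ else 0

/-- The form with restriction `P` to the linear subspace with frame `chartFrame e A`, and with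
coefficients `c` at the monomials that involve a variable outside the image of `e`. -/
noncomputable def chartForm (e : κ ↪ ι) (A : κ × {j // j ∉ Set.range e} → R)
    (P : MvPolynomial κ R) (c : OffExps e d → R) : MvPolynomial ι R :=
  rename e (P - linSub (chartFrame e A) (offForm e c)) + offForm e c

theorem map_chartForm (φ : R →+* S) (e : κ ↪ ι) (A : κ × {j // j ∉ Set.range e} → R)
    (P : MvPolynomial κ R) (c : OffExps e d → R) :
    map φ (chartForm e A P c) = chartForm e (φ ∘ A) (map φ P) (φ ∘ c) := by
  have h1 : map φ (offForm e c) = offForm e (φ ∘ c) := by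
    rw [offForm, map_formOfCoeffs]
    congr 1
    ext m
    split_ifs <;> simp
  have h2 : (fun a i => φ (chartFrame e A a i)) = chartFrame e (φ ∘ A) := by
    ext a i
    simp only [chartFrame]
    split_ifs <;> simp
  simp only [chartForm, map_add, map_rename, map_sub, map_linSub, h1, h2]

/-- A form is determined by its restriction to a linear subspace in the chart of `e` together with
its coefficients at the monomials that involve a variable outside the image of `e`. -/
theorem chartForm_eq [DecidableEq κ] {e : κ ↪ ι} {v : κ → ι → R}
    (hv : ∀ a b, v a (e b) = if a = b then 1 else 0) {F : MvPolynomial ι R}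
    (hF : F.IsHomogeneous d) :
    chartForm e (fun p => v p.1 p.2) (linSub v F) (fun m : OffExps e d => coeff m.1.1 F) = F := by
  classical
  have hframe : chartFrame e (fun p => v p.1 p.2) = v := by
    ext a i
    simp only [chartFrame]
    split_ifs with h h1
    · rw [← h1, hv, if_pos rfl]
    · obtain ⟨b, rfl⟩ := h
      rw [hv, if_neg fun hab => h1 (congrArg e hab)]
    · rfl
  rw [chartForm, hframe, ← map_sub]
  set W := offForm e (fun m : OffExps e d => coeff m.1.1 F) with hW
  have hWhom : W.IsHomogeneous d := formOfCoeffs_isHomogeneous _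
  -- The difference `F - W` only involves variables in the image of `e`.
  obtain ⟨q, hq⟩ : ∃ q : MvPolynomial κ R, rename e q = F - W := by
    refine exists_rename_eq_of_vars_subset_range _ e e.injective fun j hj => ?_
    by_contra hje
    obtain ⟨m, hm, hjm⟩ := (mem_vars_iff_mem_support _).1 hj
    have hdeg : m.degree = d := by
      by_contra hne
      exact mem_support_iff.1 hm ((hF.sub hWhom).coeff_eq_zero hne)
    have hcoeff := coeff_formOfCoeffs (fun m : Exps ι d =>
      if h : ∃ j ∉ Set.range e, m.1 j ≠ 0 then coeff m.1 F else 0) ⟨m, hdeg⟩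
    rw [dif_pos ⟨j, hje, Finsupp.mem_support_iff.1 hjm⟩] at hcoeff
    refine mem_support_iff.1 hm ?_
    rw [coeff_sub, sub_eq_zero]
    exact hcoeff.symm
  rw [← hq, linSub_rename hv, hq, sub_add_cancel]

/-- In one chart of the Grassmannian: if the restrictions depend polynomially on so few parameters
that the total number of parameters is less than the number of coefficients, then the coefficients
satisfy a nontrivial relation. -/
theorem exists_relation_chart {k : Type*} (K : Type*) [Field k] [Field K] [Algebra k K]
    [DecidableEq κ] (e : κ ↪ ι) {τ : Type} [Fintype τ] (p : MvPolynomial κ (MvPolynomial τ k))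
    (hcard : Fintype.card κ * (Fintype.card ι - Fintype.card κ) + Fintype.card τ <
      Fintype.card (Exps κ d)) :
    ∃ G : MvPolynomial (Exps ι d) k, G ≠ 0 ∧ ∀ F : MvPolynomial ι K, F.IsHomogeneous d →
      ∀ v : κ → ι → K, (∀ a b, v a (e b) = if a = b then 1 else 0) →
      ∀ y : τ → K, linSub v F = map (aeval y : MvPolynomial τ k →ₐ[k] K).toRingHom p →
        aeval (fun m : Exps ι d => coeff m.1 F) G = 0 := by
  classical
  let Off := {j // j ∉ Set.range e}
  let σ := (κ × Off) ⊕ τ ⊕ OffExps e d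
  let Φ : MvPolynomial ι (MvPolynomial σ k) :=
    chartForm (d := d) e (fun a => X (.inl a))
      (map (rename (fun t => .inr (.inl t)) : MvPolynomial τ k →ₐ[k] MvPolynomial σ k).toRingHom p)
      (fun m => X (.inr (.inr m)))
  have hOff : Fintype.card Off = Fintype.card ι - Fintype.card κ := by
    rw [Fintype.card_subtype_compl, ← Fintype.card_congr (Equiv.ofInjective e e.injective)]
  have hσ : Fintype.card σ < Fintype.card (Exps ι d) := by
    have := card_exps_add_card_offExps_le e d
    simp only [σ, Fintype.card_sum, Fintype.card_prod, hOff]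
    omega
  obtain ⟨G, hG0, hG⟩ := exists_relation hσ (fun m => coeff m.1 Φ)
  refine ⟨G, hG0, fun F hF v hv y hy => ?_⟩
  let z : σ → K := Sum.elim (fun q => v q.1 q.2) (Sum.elim y fun m => coeff m.1.1 F)
  let φ : MvPolynomial σ k →ₐ[k] K := aeval z
  have hΦ : map φ.toRingHom Φ = F := by
    rw [map_chartForm, map_map]
    have h1 : φ.toRingHom.comp
        (rename (fun t => .inr (.inl t)) : MvPolynomial τ k →ₐ[k] MvPolynomial σ k).toRingHom =
        (aeval y : MvPolynomial τ k →ₐ[k] K).toRingHom := by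
      have : φ.comp (rename (fun t => .inr (.inl t)) : MvPolynomial τ k →ₐ[k] MvPolynomial σ k) =
          aeval y := by
        ext t
        simp [φ, z]
      rw [← this]
      rfl
    rw [h1, ← hy]
    convert chartForm_eq hv hF using 2
    · ext q
      simp [φ, z]
    · ext m
      simp [φ, z]
  have h := congrArg φ hG
  rw [map_zero, ← AlgHom.comp_apply, comp_aeval] at h
  convert h using 3
  ext m
  conv_lhs => rw [← hΦ]
  rw [coeff_map]
  rfl

/-- The same for all linear subspaces, and for restrictions in a finite union of families; the
family may depend on the choice of coordinates `g` in the linear subspace. -/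
theorem exists_relation_linSub {k : Type*} (K : Type*) [Field k] [Field K] [Algebra k K]
    [DecidableEq κ] {T : Type} [Fintype T] (τ : T → Type) [∀ t, Fintype (τ t)]
    (p : ∀ t, MvPolynomial κ (MvPolynomial (τ t) k))
    (hcard : ∀ t, Fintype.card κ * (Fintype.card ι - Fintype.card κ) + Fintype.card (τ t) <
      Fintype.card (Exps κ d)) :
    ∃ G : MvPolynomial (Exps ι d) k, G ≠ 0 ∧ ∀ F : MvPolynomial ι K, F.IsHomogeneous d →
      ∀ v : κ → ι → K, LinearIndependent K v →
      (∀ g : κ → κ → K, ∃ t, ∃ y : τ t → K, linSub g (linSub v F) =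
        map (aeval y : MvPolynomial (τ t) k →ₐ[k] K).toRingHom (p t)) →
      aeval (fun m : Exps ι d => coeff m.1 F) G = 0 := by
  classical
  choose G hG0 hG using fun (e : κ ↪ ι) t => exists_relation_chart K e (p t) (hcard t)
  refine ⟨∏ e, ∏ t, G e t, Finset.prod_ne_zero_iff.2 fun e _ =>
    Finset.prod_ne_zero_iff.2 fun t _ => hG0 e t, fun F hF v hv hy => ?_⟩
  obtain ⟨e, g, heg⟩ := exists_chart hv
  obtain ⟨t, y, hty⟩ := hy g
  rw [linSub_linSub] at hty
  simp only [map_prod]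
  exact Finset.prod_eq_zero (Finset.mem_univ e)
    (Finset.prod_eq_zero (Finset.mem_univ t) (hG e t F hF _ heg y hty))

end Chart

/-! ### Hypersurfaces containing a plane curve -/

theorem Exps.card_fin_three (d : ℕ) : Fintype.card (Exps (Fin 3) d) = (d + 2).choose 2 := by
  rw [Exps.card, show 3 + d - 1 = d + 2 by omega, Nat.choose_symm_add]

instance Exps.nonempty {ι : Type} [Nonempty ι] (d : ℕ) : Nonempty (Exps ι d) :=
  ⟨⟨Finsupp.single (Classical.arbitrary ι) d, Finsupp.degree_single _ _⟩⟩

/-- The factor of a form by a form can be taken to be a form. -/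
theorem exists_isHomogeneous_mul_eq {R : Type*} [CommRing R] {σ : Type} {Q F : MvPolynomial σ R}
    {r d : ℕ} (hQ : Q.IsHomogeneous r) (hF : F.IsHomogeneous d) (hrd : r ≤ d) (h : Q ∣ F) :
    ∃ g : MvPolynomial σ R, g.IsHomogeneous (d - r) ∧ F = Q * g := by
  classical
  obtain ⟨g, rfl⟩ := h
  refine ⟨homogeneousComponent (d - r) g, homogeneousComponent_isHomogeneous _ _, ?_⟩
  let := gradedAlgebra (σ := σ) (R := R)
  have h := DirectSum.coe_decompose_mul_of_left_mem_of_le (homogeneousSubmodule σ R)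
    (b := g) (show Q ∈ homogeneousSubmodule σ R r from hQ) hrd
  rw [DirectSum.decompose_of_mem_same (homogeneousSubmodule σ R)
    (show Q * g ∈ homogeneousSubmodule σ R d from hF)] at h
  rw [h]
  congr 1
  exact decomposition.decompose'_apply g (d - r)

/-- A linear form in three variables vanishes on a two-dimensional subspace. -/
theorem exists_linSub_eq_zero {K : Type*} [Field K] {Q : MvPolynomial (Fin 3) K}
    (hQ : Q.IsHomogeneous 1) :
    ∃ w : Fin 2 → Fin 3 → K, LinearIndependent K w ∧ linSub w Q = 0 := by
  have hQ' : Q ∈ homogeneousSubmodule (Fin 3) K 1 := hQ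
  rw [homogeneousSubmodule_one_eq_span_X, Submodule.mem_span_range_iff_exists_fun] at hQ'
  obtain ⟨c, rfl⟩ := hQ'
  let l : (Fin 3 → K) →ₗ[K] K := Fintype.linearCombination K c
  have hker : 2 ≤ Module.finrank K (LinearMap.ker l) := by
    have h1 := l.finrank_range_add_finrank_ker
    have h2 := (LinearMap.range l).finrank_le
    rw [Module.finrank_fin_fun] at h1
    rw [Module.finrank_self] at h2
    omega
  obtain ⟨w, hw⟩ := exists_linearIndependent_of_le_finrank hker
  refine ⟨fun a => w a, hw.map' _ (Submodule.ker_subtype _), ?_⟩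
  have hl : ∀ a, ∑ i, (w a : Fin 3 → K) i * c i = 0 := fun a => by
    have := (w a).2
    rwa [LinearMap.mem_ker, Fintype.linearCombination_apply] at this
  have : linSub (fun a => (w a : Fin 3 → K)) (∑ i, c i • X i) =
      ∑ a, C (∑ i, (w a : Fin 3 → K) i * c i) * X a := by
    simp only [linSub, map_sum, map_smul, aeval_X]
    simp only [smul_eq_C_mul, Finset.mul_sum, Finset.sum_mul, C_mul]
    rw [Finset.sum_comm]
    exact Finset.sum_congr rfl fun a _ => Finset.sum_congr rfl fun i _ => by ring
  rw [this]
  simp [hl]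

open Classical in
/-- The product of a form of degree `r` with coefficient `1` at `m₀` and a form of degree `s`, with
all other coefficients indeterminate. Normalizing one coefficient accounts for the scalar that can
be moved between the two factors. -/
noncomputable def universalProduct (k : Type*) [CommRing k] {κ : Type} [Finite κ] {r : ℕ} (s : ℕ)
    (m₀ : Exps κ r) : MvPolynomial κ (MvPolynomial ({m // m ≠ m₀} ⊕ Exps κ s) k) :=
  formOfCoeffs (fun m => if h : m = m₀ then 1 else X (.inl ⟨m, h⟩)) *
    formOfCoeffs (fun m : Exps κ s => X (.inr m))

/-- Every product of forms of degrees `r` and `s`, the zero product included, is a specialization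
of some `universalProduct`. -/
theorem exists_map_universalProduct (k : Type*) {K : Type*} [Field k] [Field K] [Algebra k K]
    {κ : Type} [Finite κ] [Nonempty κ] {r s : ℕ} {Q g : MvPolynomial κ K}
    (hQ : Q.IsHomogeneous r) (hg : g.IsHomogeneous s) :
    ∃ (m₀ : Exps κ r) (y : {m // m ≠ m₀} ⊕ Exps κ s → K),
      Q * g = map (aeval y : MvPolynomial _ k →ₐ[k] K).toRingHom (universalProduct k s m₀) := by
  classical
  by_cases hQ0 : ∃ m : Exps κ r, coeff m.1 Q ≠ 0
  · obtain ⟨m₀, hm₀⟩ := hQ0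
    refine ⟨m₀, Sum.elim (fun m => (coeff m₀.1 Q)⁻¹ * coeff m.1.1 Q)
      (fun m => coeff m₀.1 Q * coeff m.1 g), ?_⟩
    rw [universalProduct, map_mul, map_formOfCoeffs, map_formOfCoeffs]
    have h1 : C (coeff m₀.1 Q)⁻¹ * Q = formOfCoeffs fun m : Exps κ r =>
        (coeff m₀.1 Q)⁻¹ * coeff m.1 Q := by
      rw [← formOfCoeffs_coeff (hQ.C_mul (coeff m₀.1 Q)⁻¹)]
      simp only [coeff_C_mul]
    have h2 : C (coeff m₀.1 Q) * g = formOfCoeffs fun m : Exps κ s =>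
        coeff m₀.1 Q * coeff m.1 g := by
      rw [← formOfCoeffs_coeff (hg.C_mul (coeff m₀.1 Q))]
      simp only [coeff_C_mul]
    have h3 : Q * g = (C (coeff m₀.1 Q)⁻¹ * Q) * (C (coeff m₀.1 Q) * g) := by
      rw [mul_mul_mul_comm, ← C_mul, inv_mul_cancel₀ hm₀, C_1, one_mul]
    rw [h3, h1, h2]
    congr 2
    · ext m
      split_ifs with h
      · subst h
        simp [hm₀]
      · simp
    · ext m
      simp
  · push Not at hQ0
    have hQ0' : Q = 0 := hQ.eq_of_coeff_eq (isHomogeneous_zero _ _ _) fun m => by simp [hQ0 m]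
    obtain ⟨m₀⟩ : Nonempty (Exps κ r) := inferInstance
    refine ⟨m₀, 0, ?_⟩
    rw [universalProduct, map_mul, map_formOfCoeffs, map_formOfCoeffs, hQ0', zero_mul]
    have : formOfCoeffs (fun m : Exps κ s =>
        (aeval (0 : {m // m ≠ m₀} ⊕ Exps κ s → K) : MvPolynomial _ k →ₐ[k] K).toRingHom
          (X (.inr m))) = 0 := by
      simp [formOfCoeffs]
    rw [this, mul_zero]

/-- The coefficients of the forms whose restriction to some plane is divisible by a form of degree
`r` satisfy a nontrivial relation. For `r = 1` the plane is not determined by the curve, and the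
count of parameters is made for the lines instead. -/
theorem exists_relation_planeCurve (k K : Type*) [Field k] [Field K] [Algebra k K] {N d r : ℕ}
    (hN : 3 ≤ N) (hr : 1 ≤ r) (hrd : r ≤ d)
    (hpos : (Nat.choose (d + 2) 2 : ℤ) - (Nat.choose (d - r + 2) 2 : ℤ) - xInt r N > 0) :
    ∃ G : MvPolynomial (Exps (Fin (N + 1)) d) k, G ≠ 0 ∧
      ∀ F : MvPolynomial (Fin (N + 1)) K, F.IsHomogeneous d → ∀ C : PlaneCurve K N r,
        C.form ∣ C.restrict F → aeval (fun m : Exps (Fin (N + 1)) d => coeff m.1 F) G = 0 := by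
  classical
  obtain rfl | hr1 := hr.eq_or_lt
  · have hcard : 2 * (N + 1 - 2) < d + 1 := by
      have h1 : (d + 2).choose 2 = (d - 1 + 2).choose 2 + (d + 1) := by
        rw [show d - 1 + 2 = d + 1 by omega, Nat.choose_succ_succ' (d + 1) 1, Nat.choose_one_right,
          add_comm]
      simp only [xInt, if_true] at hpos
      omega
    obtain ⟨G, hG0, hG⟩ := exists_relation_linSub (k := k) (ι := Fin (N + 1)) (κ := Fin 2) (d := d)
      K (T := Unit) (fun _ => Fin 0) (fun _ => 0) fun _ => by
        rw [Exps.card, show 2 + d - 1 = d + 1 by omega, Nat.choose_succ_self_right]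
        simpa using hcard
    refine ⟨G, hG0, fun F hF C hC => ?_⟩
    obtain ⟨w, hw, hw0⟩ := exists_linSub_eq_zero C.form_homogeneous
    have hli : LinearIndependent K fun a i => ∑ c, w a c * C.frame c i := by
      have h : (fun a i => ∑ c, w a c * C.frame c i) =
          Fintype.linearCombination K C.frame ∘ w := by
        ext a i
        simp [Fintype.linearCombination_apply]
      rw [h]
      exact hw.map' _
        (LinearMap.ker_eq_bot.2 C.linearIndependent_frame.fintypeLinearCombination_injective)
    refine hG F hF _ hli fun g => ⟨(), 0, ?_⟩
    have h0 : linSub w (linSub C.frame F) = 0 := by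
      obtain ⟨q, hq⟩ := hC
      rw [show linSub C.frame F = C.form * q from hq, map_mul, hw0, zero_mul]
    rw [← linSub_linSub, h0, map_zero, map_zero]
  · obtain ⟨G, hG0, hG⟩ := exists_relation_linSub (k := k) (ι := Fin (N + 1)) (κ := Fin 3) (d := d)
      K (T := Exps (Fin 3) r) _ (universalProduct k (d - r)) fun m₀ => by
        rw [Fintype.card_sum, Exps.card_fin_three, Exps.card_fin_three,
          Fintype.card_subtype_compl, Exps.card_fin_three]
        simp only [xInt, if_neg hr1.ne'] at hpos
        have : 0 < (r + 2).choose 2 := Nat.choose_pos (by omega)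
        simp
        omega
    refine ⟨G, hG0, fun F hF C hC => hG F hF _ C.linearIndependent_frame fun g => ?_⟩
    obtain ⟨q, hq, h⟩ := exists_isHomogeneous_mul_eq C.form_homogeneous
      (linSub_isHomogeneous C.frame hF) hrd hC
    rw [h, map_mul]
    exact exists_map_universalProduct k (linSub_isHomogeneous g C.form_homogeneous)
      (linSub_isHomogeneous g hq)

namespace Hypersurface

theorem equation_isHomogeneous {K : Type*} [Field K] {N d : ℕ} (H : Hypersurface K N d) :
    (equation H).IsHomogeneous d :=
  (Projectivization.rep H : FormSpace K N d).2

theorem Contains.dvd {K : Type*} [Field K] {N d r : ℕ} {H : Hypersurface K N d}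
    {C : PlaneCurve K N r} (h : Contains H C) : C.form ∣ C.restrict (equation H) :=
  Ideal.mem_span_singleton.1 (h (Ideal.mem_span_singleton_self _))

/-- Every nonzero vector is, up to a nonzero scalar, the vector of coordinates of a hypersurface. -/
theorem exists_coords_eq_smul {K : Type*} [Field K] {N d : ℕ} {y : Exponent N d → K} (hy : y ≠ 0) :
    ∃ (H : Hypersurface K N d) (a : Kˣ), coords H = (a : K) • y := by
  have hne : (⟨formOfCoeffs y, formOfCoeffs_isHomogeneous y⟩ : FormSpace K N d) ≠ 0 := fun h =>
    hy <| funext fun m => by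
      rw [← coeff_formOfCoeffs y m, show formOfCoeffs y = 0 from congrArg Subtype.val h, coeff_zero,
        Pi.zero_apply]
  obtain ⟨a, ha⟩ := Projectivization.exists_smul_eq_mk_rep K _ hne
  refine ⟨Projectivization.mk K _ hne, a, funext fun m => ?_⟩
  rw [coords, equation, ← ha, Pi.smul_apply, ← coeff_formOfCoeffs y m]
  exact coeff_smul _ _ _

/-- The complement of the zero locus of a nonzero form on the space of hypersurfaces is nonempty
over an infinite field. -/
theorem exists_aeval_coords_ne_zero {k K : Type*} [Field k] [Field K] [Algebra k K] [Infinite K]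
    {N d s : ℕ} {G : MvPolynomial (Exponent N d) k} (hG : G.IsHomogeneous s) (hG0 : G ≠ 0) :
    ∃ H : Hypersurface K N d, aeval (coords H) G ≠ 0 := by
  let m₀ : Exponent N d := Classical.choice (Exps.nonempty d)
  -- The factor `X m₀` keeps the point away from the origin when `G` is a constant.
  obtain ⟨y, hy⟩ : ∃ y : Exponent N d → K, aeval y (G * X m₀) ≠ 0 := by
    by_contra! h
    refine mul_ne_zero hG0 (X_ne_zero m₀) (map_injective _ (algebraMap k K).injective ?_)
    rw [map_zero]
    exact MvPolynomial.funext fun y => by rw [eval_map, ← aeval_def, h y, map_zero]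
  rw [map_mul, aeval_X] at hy
  obtain ⟨H, a, ha⟩ := exists_coords_eq_smul (y := y) fun h0 =>
    right_ne_zero_of_mul hy (by simp [h0])
  refine ⟨H, ?_⟩
  rw [ha, hG.aeval_smul]
  exact mul_ne_zero (pow_ne_zero _ a.ne_zero) (left_ne_zero_of_mul hy)

end Hypersurface

theorem theoremA1 (k K : Type*) [Field k] [Field K] [Algebra k K] [IsAlgClosure k K]
    (N d r : ℕ) (hN : 3 ≤ N) (hr : 1 ≤ r) (hrd : r ≤ d)
    (hpos : (Nat.choose (d + 2) 2 : ℤ) - (Nat.choose (d - r + 2) 2 : ℤ) - xInt r N > 0) :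
    ∃ U : Set (Hypersurface K N d),
      Hypersurface.IsZariskiOpen k U ∧ U.Nonempty ∧
      ∀ H ∈ U, ∀ C : PlaneCurve K N r, ¬ Hypersurface.Contains H C := by
  have : IsAlgClosed K := IsAlgClosure.isAlgClosed k
  have : Infinite K := IsAlgClosed.instInfinite
  obtain ⟨G, hG0, hG⟩ := exists_relation_planeCurve k K hN hr hrd hpos
  obtain ⟨s, G', hG', hG'0, hcone⟩ := exists_homogeneous_vanishing_on_cone (K := K) hG0
  refine ⟨{H | aeval (Hypersurface.coords H) G' ≠ 0}, ⟨{G'}, by simpa using ⟨s, hG'⟩, by simp⟩,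
    Hypersurface.exists_aeval_coords_ne_zero hG' hG'0, fun H hH C hC => hH ?_⟩
  refine hcone _ fun c => ?_
  have hdvd : C.form ∣ C.restrict (MvPolynomial.C c * Hypersurface.equation H) := by
    rw [map_mul]
    exact hC.dvd.mul_left _
  convert hG _ (H.equation_isHomogeneous.C_mul c) C hdvd using 3
  ext m
  simp [Hypersurface.coords]
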